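/- Time and data amounts are in $[0,\infty)$. A cumulative function is a nondecreasing, left-continuous $R:[0,\infty)\to[0,\infty)$ with $R(0)=0$. Write $R\sim\alpha$ if $R(t)-R(s)\le\alpha(t-s)$ for all $0\le s\le t$, and $(R\otimes\beta)(t)=\inf_{0\le s\le t}\big(R(s)+\beta(t-s)\big)$. A system is given by its possible pairs (input, output) of traffics, a traffic consisting of one cumulative function per flow. It is causal and lossless if the output of each flow never exceeds its input, data that has not left being stored and never dropped. It is FIFO if data that entered earlier never leaves after data that entered later. It offers the service curve $\beta$ if $\beta$ is nondecreasing and the aggregate input $R$ and output $R^*$ always satisfy $R^*\ge R\otimes\beta$. A packet sequence consists of nondecreasing instants $B_n\in[0,\infty]$ ($\infty$: never) and sizes $L_n>0$ ($n\ge 1$), finitely many packets crossing in bounded time; its cumulative function is $t\mapsto\sum_n L_n\mathbf 1_{\{B_n<t\}}$. When a packetizer receives the bits of these packets as a fluid stream $R$, it releases packet $n$ at $\inf\{t: R(t)\ge L_1+\dots+L_n\}$, i.e. when its last bit is received. A system $Z$ with packetized input and output offers $\beta$, $\beta(0)=0$, as a fluid service curve if there is a causal, lossless, FIFO system $Z'$,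 defined for all inputs, that offers the service curve $\beta$, such that on the acceptable inputs of $Z$ its outputs are exactly those of $Z'$ followed by a packetizer. The per-flow regulator (PFR) of a single flow $f$ with shaping curve $\sigma_f$ releases the packets in order of arrival, packet $n$ at the earliest time, not before its arrival nor before the release of packets $1,\dots,n-1$, such that the output formed by packets $1,\dots,n$ is $\sigma_f$-constrained (never, if there is no such time). Its acceptable inputs are the packet sequences of $f$ with all sizes at most $L_f^{\max}$. For an aggregate cumulative function $R^{A}$ at a point $A$ and $R^{B}$ at a later point $B$, the delay at $t$ is $\inf\{\tau\ge0: R^{A}(t)\le R^{B}(t+\tau)\}\in[0,\infty]$, and the worst-case delay over a set of trajectories is the supremum over these trajectories and over $t\ge0$. A function $\beta$ with $\beta(0)=0$ explains the shaping-for-free property for $(\sigma_f)_{f\in\mathcal F}$ if for all causal, lossless, FIFO systems $S$ and $Z'$ such that $Z'$ offers the service curve $\beta$, in the network $A\to S\to B\to Z'\to C$ the worst-case delays of the aggregate from $A$ to $B$ and from $A$ to $C$, both over the set of all trajectories with $R_f^{A}\sim\sigma_f$ for every $f\in\mathcal F$, are equal. **Proposition.** Let a PFR shape a single flow $\mathcal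 F=\{f\}$ with a concave shaping curve $\sigma_f:[0,\infty)\to[0,\infty)$, $\sigma_f(0)=0$, such that $\lim_{t\to0^+}\sigma_f(t)\ge L_f^{\max}$. Then (1) the PFR offers $\sigma_f$ as a fluid service curve, and (2) $\sigma_f$ explains the shaping-for-free property for $\mathcal F=\{f\}$: a causal, lossless, FIFO system that offers $\sigma_f$ as a service curve, placed after any causal, lossless, FIFO system whose input is $\sigma_f$-constrained, does not increase the worst-case delay. -/

import Mathlib

open Filter Topology
open scoped NNReal ENNReal

/-! ### Cumulative functions, arrival curves, service curves -/

/-- A cumulative function: the amount of data seen at an observation point before time `t`.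
It vanishes at `0`, is wide-sense increasing and left-continuous. -/
structure CumulFn where
  toFun : ℝ≥0 → ℝ≥0
  zero' : toFun 0 = 0
  mono' : Monotone toFun
  left_cont' : ∀ t, ContinuousWithinAt toFun (Set.Iic t) t

/-- The traffic of the flows `ι` at an observation point: one cumulative function per flow. -/
abbrev Traffic (ι : Type) := ι → CumulFn

/-- The cumulative function of the aggregate of all flows. -/
noncomputable def Traffic.aggregate {ι : Type} [Fintype ι] (R : Traffic ι) (t : ℝ≥0) : ℝ≥0 :=
  ∑ f, (R f).toFun t

/-- `R ∼ α`: `R t - R s ≤ α (t - s)` for all `s ≤ t`. -/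
def ConstrainedBy (R α : ℝ≥0 → ℝ≥0) : Prop :=
  ∀ s t : ℝ≥0, s ≤ t → R t ≤ R s + α (t - s)

/-- Min-plus convolution `(f ⊗ g) t = inf_{s ≤ t} (f s + g (t - s))`. -/
noncomputable def minPlusConv (f g : ℝ≥0 → ℝ≥0) (t : ℝ≥0) : ℝ≥0 :=
  ⨅ s : Set.Iic t, (f s.1 + g (t - s.1))

/-- A system, given by its trajectories: `S a b` says that `b` is a possible output traffic
for the input traffic `a`. -/
abbrev System (ι : Type) := Traffic ι → Traffic ι → Prop

/-- Causal and lossless: no data is produced inside, so for every flow what has left has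
entered before. Data that has entered and not left is stored in the system and not dropped, so
that the `q`-th bit of a flow at the output is its `q`-th bit at the input. -/
def IsCausalLossless {ι : Type} (S : System ι) : Prop :=
  ∀ a b, S a b → ∀ f t, (b f).toFun t ≤ (a f).toFun t

/-- FIFO for the aggregate: at time `t`, it is impossible that data of one flow that entered
before time `s` is still inside while data (of any flow) that entered at or after `s` has
already left. -/
def IsFIFO {ι : Type} (S : System ι) : Prop :=
  ∀ a b, S a b → ∀ s t,
    (∀ f, (b f).toFun t ≤ (a f).toFun s) ∨ (∀ f, (a f).toFun s ≤ (b f).toFun t)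

/-- `S` offers (to the aggregate) the service curve `β`. -/
def OffersServiceCurve {ι : Type} [Fintype ι] (S : System ι) (β : ℝ≥0 → ℝ≥0) : Prop :=
  Monotone β ∧ ∀ a b, S a b → ∀ t, minPlusConv a.aggregate β t ≤ b.aggregate t

/-! ### Packet sequences, packetizer, fluid service curves -/

/-- A packet sequence: arrival instants in chronological order, sizes and flows of the packets
`0, 1, 2, …`. The instant `∞` means that the packet never crosses the observation point (so
finite sequences are included). Only finitely many packets cross in bounded time. -/
@[ext]
structure PacketSeq (ι : Type) where
  time : ℕ → ℝ≥0∞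
  len : ℕ → ℝ≥0
  flow : ℕ → ι
  mono : Monotone time
  len_pos : ∀ n, 0 < len n
  finite : ∀ t : ℝ≥0, {n | time n < t}.Finite

open Classical in
/-- The cumulative functions of a packet sequence: flow `f` has sent before `t` the total size
of its packets `n` with `time n < t`. -/
noncomputable def PacketSeq.cumul {ι : Type} (P : PacketSeq ι) : Traffic ι := fun f =>
  { toFun := fun t => ∑ n ∈ (P.finite t).toFinset with P.flow n = f, P.len n
    zero' := by simp
    mono' := by
      intro s t hst
      apply Finset.sum_le_sum_of_subset
      intro n
      simp only [Finset.mem_filter, Set.Finite.mem_toFinset, Set.mem_setOf_eq]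
      rintro ⟨h1, h2⟩
      exact ⟨h1.trans_le (by exact_mod_cast hst), h2⟩
    left_cont' := by
      intro t
      have key : ∀ᶠ s : ℝ≥0 in 𝓝[Set.Iic t] t, ∀ n ∈ {n | P.time n < t}, P.time n < s := by
        rw [Filter.eventually_all_finite (P.finite t)]
        intro n hn
        have hc : Tendsto (fun s : ℝ≥0 => (s : ℝ≥0∞)) (𝓝[Set.Iic t] t) (𝓝 (t : ℝ≥0∞)) :=
          (ENNReal.continuous_coe.tendsto t).mono_left nhdsWithin_le_nhds
        exact hc.eventually (lt_mem_nhds hn)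
      apply tendsto_const_nhds.congr'
      filter_upwards [key, self_mem_nhdsWithin] with s hs hst
      have hst' : (s : ℝ≥0∞) ≤ t := by exact_mod_cast hst
      congr 1
      ext n
      simp only [Finset.mem_filter, Set.Finite.mem_toFinset, Set.mem_setOf_eq]
      exact ⟨fun h => ⟨hs n h.1, h.2⟩, fun h => ⟨h.1.trans_le hst', h.2⟩⟩ }

/-- `Q` is what a packetizer outputs when it receives the bits of the packets of `P` (in the
order of `P`) as the fluid traffic `c`: packet `n` is released at the instant
`inf {t | len 0 + ⋯ + len n ≤ c t}` at which its last bit is received (never, if it is `∞`). -/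
def IsPacketizerOutput {ι : Type} [Fintype ι] (P : PacketSeq ι) (c : Traffic ι)
    (Q : PacketSeq ι) : Prop :=
  Q.len = P.len ∧ Q.flow = P.flow ∧
    ∀ n, Q.time n =
      ⨅ (t : ℝ≥0) (_ : ∑ m ∈ Finset.range (n + 1), P.len m ≤ c.aggregate t), (t : ℝ≥0∞)

/-- A system with packetized input and output: `Z P Q` says that `Q` is a possible output for
the input `P`; the acceptable inputs are those that have an output. -/
abbrev PacketSystem (ι : Type) := PacketSeq ι → PacketSeq ι → Prop

/-- `Z` offers `β` as a fluid service curve: there is a (causal, lossless, FIFO) system `Z'`,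
defined for every input, that offers the service curve `β`, such that on its acceptable inputs
`Z` has the same outputs as `Z'` followed by a packetizer. -/
def OffersFluidServiceCurve {ι : Type} [Fintype ι] (Z : PacketSystem ι) (β : ℝ≥0 → ℝ≥0) :
    Prop :=
  β 0 = 0 ∧ ∃ Z' : System ι, (∀ a, ∃ b, Z' a b) ∧ IsCausalLossless Z' ∧ IsFIFO Z' ∧
    OffersServiceCurve Z' β ∧
    ∀ P, (∃ Q, Z P Q) → ∀ Q, Z P Q ↔ ∃ c, Z' P.cumul c ∧ IsPacketizerOutput P c Q

/-! ### The per-flow regulator -/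

/-- Release time of packet `n` by the per-flow regulator with shaping curve `σ`: the earliest
`t` that is not before the arrival of the packet nor before the release of a previous packet
and such that the output made of the packets `0, …, n` is `σ`-constrained (`∞` if there is no
such finite time). -/
noncomputable def pfrTime (σ : ℝ≥0 → ℝ≥0) (P : PacketSeq Unit) (n : ℕ) : ℝ≥0∞ :=
  sInf {t : ℝ≥0∞ | P.time n ≤ t ∧ (∀ m : Fin n, pfrTime σ P m ≤ t) ∧
    ConstrainedBy
      (fun u : ℝ≥0 => (∑ m : Fin n, if pfrTime σ P m < u then P.len m else 0) +
        (if t < u then P.len n else 0)) σ}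
termination_by n
decreasing_by all_goals exact m.2

theorem time_le_pfrTime (σ : ℝ≥0 → ℝ≥0) (P : PacketSeq Unit) (n : ℕ) :
    P.time n ≤ pfrTime σ P n := by
  rw [pfrTime]
  exact le_sInf fun t ht => ht.1

theorem pfrTime_mono (σ : ℝ≥0 → ℝ≥0) (P : PacketSeq Unit) : Monotone (pfrTime σ P) := by
  intro m n hmn
  rcases hmn.eq_or_lt with rfl | h
  · exact le_rfl
  · rw [pfrTime.eq_def σ P n]
    exact le_sInf fun t ht => ht.2.1 ⟨m, h⟩

/-- The packet sequence at the output of the per-flow regulator. -/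
noncomputable def pfrOutput (σ : ℝ≥0 → ℝ≥0) (P : PacketSeq Unit) : PacketSeq Unit where
  time := pfrTime σ P
  len := P.len
  flow := P.flow
  mono := pfrTime_mono σ P
  len_pos := P.len_pos
  finite := fun t => (P.finite t).subset fun n hn => (time_le_pfrTime σ P n).trans_lt hn

/-- The per-flow regulator with shaping curve `σ`, for a single flow (`Unit`) whose packets have
size at most `Lmax`. -/
def pfr (σ : ℝ≥0 → ℝ≥0) (Lmax : ℝ≥0) : PacketSystem Unit := fun P Q =>
  (∀ n, P.len n ≤ Lmax) ∧ Q = pfrOutput σ P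

/-! ### Delays and the shaping-for-free property -/

/-- Delay of the data that crosses the input before `t`: `inf {τ ≥ 0 | a t ≤ b (t + τ)}` for the
aggregates, with value `∞` if this data never leaves. -/
noncomputable def delay {ι : Type} [Fintype ι] (a b : Traffic ι) (t : ℝ≥0) : ℝ≥0∞ :=
  ⨅ (τ : ℝ≥0) (_ : a.aggregate t ≤ b.aggregate (t + τ)), (τ : ℝ≥0∞)

/-- The trajectories `(a, b, c)` of the network `A → S → B → Z' → C` in which every flow `f` is
`σ f`-constrained at `A`. -/
def constrainedTrajectories {ι : Type} (σ : ι → ℝ≥0 → ℝ≥0) (S Z' : System ι) :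
    Set (Traffic ι × Traffic ι × Traffic ι) :=
  {x | S x.1 x.2.1 ∧ Z' x.2.1 x.2.2 ∧ ∀ f, ConstrainedBy (x.1 f).toFun (σ f)}

/-- `β` explains the shaping-for-free property for the shaping curves `σ`: for all causal,
lossless and FIFO systems `S` and `Z'` such that `Z'` offers the service curve `β`, the
worst-case delays of the aggregate from `A` to `B` and from `A` to `C` are equal. -/
def ExplainsShapingForFree {ι : Type} [Fintype ι] (σ : ι → ℝ≥0 → ℝ≥0) (β : ℝ≥0 → ℝ≥0) : Prop :=
  β 0 = 0 ∧ ∀ S Z' : System ι, IsCausalLossless S → IsFIFO S → IsCausalLossless Z' → IsFIFO Z' →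
    OffersServiceCurve Z' β →
    (⨆ x ∈ constrainedTrajectories σ S Z', ⨆ t, delay x.1 x.2.1 t) =
      ⨆ x ∈ constrainedTrajectories σ S Z', ⨆ t, delay x.1 x.2.2 t

/-! ### Concave curves -/

section Concave

variable {σ : ℝ≥0 → ℝ≥0}

/-! For (1), the fluid system is the greedy shaper R ↦ R ⊗ σ, and the regulator releases each packet
exactly when shaper and packetizer do (`pfrTime_eq_shapedTime`). The shaper is never later: the
constraint on the regulator's output, compared with the input at each s, bounds the released total
by R ⊗ σ. It is never earlier because the packetized shaper output is itself σ-constrained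
(`total_le_add_of_shapedTime`), hence admissible for the regulator. Packetization could create
bursts, but concavity charges the part of the first packet already served against the initial jump
of σ, which is at least one packet.

For (2), if D bounds the delay from A to B, then R^B(s) ≥ R^A(s - D), so the constraint at A gives
R^A(t) ≤ R^B(s) + σ(t + D - s) for every s in [D, t + D]; for s < D, R^A(t) ≤ σ(t) suffices. Taking
the infimum over s, R^A(t) ≤ (R^B ⊗ σ)(t + D) ≤ R^C(t + D). -/

theorem ConcaveOn.nnreal_monotone (hσ : ConcaveOn ℝ≥0 Set.univ σ) : Monotone σ := by
  intro x y hxy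
  obtain ⟨h, rfl⟩ := exists_add_of_le hxy
  refine NNReal.le_of_forall_lt_one_mul_le fun a ha => ?_
  obtain ⟨b, hb⟩ := exists_add_of_le ha.le
  have hb0 : b ≠ 0 := by
    rintro rfl
    simp at hb
    exact ha.ne hb.symm
  -- The far point has weight b and a nonnegative value, which is dropped; a tends to 1.
  have key := hσ.2 (Set.mem_univ x) (Set.mem_univ (x + h / b)) (zero_le : 0 ≤ a)
    (zero_le : 0 ≤ b) hb.symm
  have e : a • x + b • (x + h / b) = x + h := by
    simp only [smul_eq_mul]
    rw [mul_add, mul_div_cancel₀ _ hb0, ← add_assoc, ← add_mul, ← hb, one_mul]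
  rw [e] at key
  exact le_self_add.trans key

theorem ConcaveOn.nnreal_mul_le (hσ : ConcaveOn ℝ≥0 Set.univ σ) {a : ℝ≥0} (ha : a ≤ 1)
    (x : ℝ≥0) : a * σ x ≤ σ (a * x) := by
  obtain ⟨b, hb⟩ := exists_add_of_le ha
  have key := hσ.2 (Set.mem_univ x) (Set.mem_univ 0) (zero_le : 0 ≤ a)
    (zero_le : 0 ≤ b) hb.symm
  simp only [smul_eq_mul, mul_zero, add_zero] at key
  exact le_self_add.trans key

/-- Right continuity away from 0, used to remove an arbitrarily small enlargement of a window. -/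
theorem ConcaveOn.nnreal_le_of_forall_gt (hσ : ConcaveOn ℝ≥0 Set.univ σ) {x y : ℝ≥0}
    (hx : 0 < x) (h : ∀ z, x < z → y ≤ σ z) : y ≤ σ x := by
  refine NNReal.le_of_forall_lt_one_mul_le fun a ha => ?_
  rcases eq_or_ne a 0 with rfl | ha0
  · simp
  · have hlt : x < x / a := by
      rw [lt_div_iff₀ (pos_iff_ne_zero.2 ha0)]
      exact mul_lt_of_lt_one_right hx ha
    calc a * y ≤ a * σ (x / a) := by gcongr; exact h _ hlt
      _ ≤ σ (a * (x / a)) := hσ.nnreal_mul_le ha.le _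
      _ = σ x := by rw [mul_div_cancel₀ _ ha0]

/-- The two inner points are convex combinations of the outer two with swapped weights, so the two
concavity inequalities add up. -/
theorem ConcaveOn.nnreal_exchange (hσ : ConcaveOn ℝ≥0 Set.univ σ) (e α β : ℝ≥0) :
    σ (e + α + β) + σ e ≤ σ (e + α) + σ (e + β) := by
  rcases eq_or_ne (α + β) 0 with h0 | h0
  · obtain ⟨rfl, rfl⟩ := add_eq_zero.1 h0
    simp
  have hab : α / (α + β) + β / (α + β) = 1 := by rw [← add_div, div_self h0]
  have k1 := hσ.2 (Set.mem_univ (e + α + β)) (Set.mem_univ e)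
    (zero_le : 0 ≤ α / (α + β)) (zero_le : 0 ≤ β / (α + β)) hab
  have k2 := hσ.2 (Set.mem_univ (e + α + β)) (Set.mem_univ e)
    (zero_le : 0 ≤ β / (α + β)) (zero_le : 0 ≤ α / (α + β)) (by rw [add_comm, hab])
  have e1 : (α / (α + β)) • (e + α + β) + (β / (α + β)) • e = e + α := by
    simp only [smul_eq_mul]; field_simp; ring
  have e2 : (β / (α + β)) • (e + α + β) + (α / (α + β)) • e = e + β := by
    simp only [smul_eq_mul]; field_simp; ring
  rw [e1] at k1
  rw [e2] at k2
  refine le_trans (le_of_eq ?_) (add_le_add k1 k2)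
  simp only [smul_eq_mul]
  calc σ (e + α + β) + σ e
      = (α / (α + β) + β / (α + β)) * (σ (e + α + β) + σ e) := by rw [hab, one_mul]
    _ = _ := by ring

theorem Monotone.le_of_tendsto_nhdsGT_zero (hσ : Monotone σ) {l : ℝ≥0}
    (hl : Tendsto σ (𝓝[>] 0) (𝓝 l)) {x : ℝ≥0} (hx : 0 < x) : l ≤ σ x := by
  refine _root_.le_of_tendsto hl ?_
  filter_upwards [Ioo_mem_nhdsGT hx] with y hy using hσ hy.2.le

end Concave

/-! ### Min-plus convolution and the greedy shaper -/

section Conv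

variable {f g : ℝ≥0 → ℝ≥0}

theorem le_minPlusConv_iff {x t : ℝ≥0} :
    x ≤ minPlusConv f g t ↔ ∀ s ≤ t, x ≤ f s + g (t - s) := by
  have : Nonempty (Set.Iic t) := ⟨⟨t, Set.self_mem_Iic⟩⟩
  unfold minPlusConv
  rw [le_ciInf_iff (OrderBot.bddBelow _)]
  simp

theorem minPlusConv_le {s t : ℝ≥0} (h : s ≤ t) : minPlusConv f g t ≤ f s + g (t - s) :=
  le_minPlusConv_iff.1 le_rfl s h

theorem minPlusConv_le_left (hg : g 0 = 0) (t : ℝ≥0) : minPlusConv f g t ≤ f t := by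
  simpa [hg] using minPlusConv_le (f := f) (g := g) (le_refl t)

theorem minPlusConv_mono (hf : Monotone f) (hg : Monotone g) (hg0 : g 0 = 0) :
    Monotone (minPlusConv f g) := by
  intro u t hut
  rw [le_minPlusConv_iff]
  intro s _
  rcases le_total s u with hsu | hus
  · refine (minPlusConv_le hsu).trans ?_
    gcongr
    exact hg (tsub_le_tsub_right hut s)
  · exact (minPlusConv_le_left hg0 u).trans ((hf hus).trans le_self_add)

/-- Near t, the terms with s close to t are large by left continuity of f. For the others, concavity
compares g (u - s) with g (t - s) up to a factor that is uniform in s and tends to 1 as u → t. -/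
theorem minPlusConv_leftCont (hf : Monotone f)
    (hfc : ∀ t, ContinuousWithinAt f (Set.Iic t) t) (hg : ConcaveOn ℝ≥0 Set.univ g)
    (hg0 : g 0 = 0) (t : ℝ≥0) : ContinuousWithinAt (minPlusConv f g) (Set.Iic t) t := by
  have hgm := hg.nnreal_monotone
  have hcm := minPlusConv_mono hf hgm hg0
  rcases eq_or_ne t 0 with rfl | ht0
  · have : Set.Iic (0 : ℝ≥0) = {0} := by ext x; simp
    rw [this]
    exact continuousWithinAt_singleton
  refine tendsto_order.2 ⟨fun x hx => ?_, fun x hx => ?_⟩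
  swap
  · filter_upwards [self_mem_nhdsWithin] with u hu using (hcm hu).trans_lt hx
  obtain ⟨y, hxy, hyc⟩ := exists_between hx
  have hfy : ∀ᶠ s in 𝓝[Set.Iic t] t, y < f s :=
    (hfc t).eventually (lt_mem_nhds (hyc.trans_le (minPlusConv_le_left hg0 t)))
  obtain ⟨w, hwt, hw⟩ :=
    (mem_nhdsLE_iff_exists_Ioc_subset' (pos_iff_ne_zero.2 ht0)).1 hfy
  have hwt : w < t := hwt
  have hd : t - w ≠ 0 := (tsub_pos_of_lt hwt).ne'
  have hlim : Tendsto (fun u : ℝ≥0 => (u - w) / (t - w) * minPlusConv f g t) (𝓝[Set.Iic t] t)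
      (𝓝 (minPlusConv f g t)) := by
    have hc : Continuous fun u : ℝ≥0 => (u - w) / (t - w) * minPlusConv f g t := by fun_prop
    have := hc.tendsto t
    rw [div_self hd, one_mul] at this
    exact this.mono_left nhdsWithin_le_nhds
  filter_upwards [hlim.eventually (lt_mem_nhds hyc), Ioc_mem_nhdsLE hwt] with u hu huw
  refine hxy.trans_le (le_minPlusConv_iff.2 fun s hsu => ?_)
  rcases lt_or_ge w s with hws | hsw
  · exact (hw ⟨hws, hsu.trans huw.2⟩ : y < f s).le.trans le_self_add
  have ha1 : (u - w) / (t - w) ≤ 1 :=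
    div_le_one_of_le₀ (tsub_le_tsub_right huw.2 w) zero_le
  -- After clearing denominators, the difference of the two sides is (w - s)(t - u).
  have harg : (u - w) / (t - w) * (t - s) ≤ u - s := by
    rw [div_mul_eq_mul_div, div_le_iff₀ (pos_iff_ne_zero.2 hd), ← NNReal.coe_le_coe]
    push_cast [NNReal.coe_sub huw.1.le, NNReal.coe_sub hwt.le,
      NNReal.coe_sub (hsu.trans huw.2), NNReal.coe_sub hsu]
    have h1 : (s : ℝ) ≤ w := hsw
    have h2 : (u : ℝ) ≤ t := huw.2
    nlinarith [mul_nonneg (sub_nonneg.2 h1) (sub_nonneg.2 h2)]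
  calc y ≤ (u - w) / (t - w) * minPlusConv f g t := hu.le
    _ ≤ (u - w) / (t - w) * (f s + g (t - s)) := by
        gcongr
        exact minPlusConv_le (hsu.trans huw.2)
    _ = (u - w) / (t - w) * f s + (u - w) / (t - w) * g (t - s) := mul_add _ _ _
    _ ≤ f s + g (u - s) :=
        add_le_add (mul_le_of_le_one_left zero_le ha1)
          ((hg.nnreal_mul_le ha1 _).trans (hgm harg))

end Conv

theorem Traffic.aggregate_unit (R : Traffic Unit) : R.aggregate = (R ()).toFun := by
  funext t
  simp [Traffic.aggregate]

/-- The output of the greedy shaper with shaping curve `σ` for the input `R`. -/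
noncomputable def CumulFn.shape (R : CumulFn) {σ : ℝ≥0 → ℝ≥0} (hσ0 : σ 0 = 0)
    (hσ : ConcaveOn ℝ≥0 Set.univ σ) : CumulFn where
  toFun := minPlusConv R.toFun σ
  zero' := by
    have := minPlusConv_le_left (f := R.toFun) hσ0 0
    rw [R.zero'] at this
    exact le_antisymm this zero_le
  mono' := minPlusConv_mono R.mono' hσ.nnreal_monotone hσ0
  left_cont' := minPlusConv_leftCont R.mono' R.left_cont' hσ hσ0

/-- The greedy shaper of a single flow. -/
def greedyShaper (σ : ℝ≥0 → ℝ≥0) : System Unit := fun a c =>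
  ∀ t, (c ()).toFun t = minPlusConv (a ()).toFun σ t

/-! ### Single-flow packet sequences -/

namespace PacketSeq

variable (P : PacketSeq Unit)

/-- Total size of the first `n` packets. -/
def total (n : ℕ) : ℝ≥0 := ∑ m ∈ Finset.range n, P.len m

theorem total_succ (n : ℕ) : P.total (n + 1) = P.total n + P.len n :=
  Finset.sum_range_succ _ _

theorem total_mono : Monotone P.total := fun _ _ h =>
  Finset.sum_le_sum_of_subset (Finset.range_subset_range.2 h)

theorem cumul_unit (t : ℝ≥0) :
    (P.cumul ()).toFun t = ∑ n ∈ (P.finite t).toFinset, P.len n := by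
  simp [PacketSeq.cumul]

theorem total_le_cumul {n : ℕ} {t : ℝ≥0} (h : P.time n < t) :
    P.total (n + 1) ≤ (P.cumul ()).toFun t := by
  rw [cumul_unit]
  refine Finset.sum_le_sum_of_subset fun m hm => ?_
  simp only [Set.Finite.mem_toFinset, Set.mem_ofPred_eq]
  exact (P.mono (Nat.lt_succ_iff.1 (Finset.mem_range.1 hm))).trans_lt h

theorem cumul_le_total {n : ℕ} {t : ℝ≥0} (h : ¬ P.time n < t) :
    (P.cumul ()).toFun t ≤ P.total n := by
  rw [cumul_unit]
  refine Finset.sum_le_sum_of_subset fun m hm => ?_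
  simp only [Set.Finite.mem_toFinset, Set.mem_ofPred_eq] at hm
  rw [Finset.mem_range]
  by_contra hn
  exact h ((P.mono (not_lt.1 hn)).trans_lt hm)

theorem time_lt_of_total_le {n : ℕ} {t : ℝ≥0} (h : P.total (n + 1) ≤ (P.cumul ()).toFun t) :
    P.time n < t := by
  by_contra hn
  have := h.trans (P.cumul_le_total hn)
  rw [total_succ] at this
  exact absurd this (not_le.2 (lt_add_of_pos_right _ (P.len_pos n)))

theorem sum_ite_le_cumul {τ : ℕ → ℝ≥0∞} {n : ℕ} (hτ : ∀ m < n, P.time m ≤ τ m) (s : ℝ≥0) :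
    (∑ m ∈ Finset.range n, if τ m < s then P.len m else 0) ≤ (P.cumul ()).toFun s := by
  rw [cumul_unit, ← Finset.sum_filter]
  refine Finset.sum_le_sum_of_subset fun m hm => ?_
  simp only [Finset.mem_filter, Finset.mem_range] at hm
  simp only [Set.Finite.mem_toFinset, Set.mem_ofPred_eq]
  exact (hτ m hm.1).trans_lt hm.2

/-- Instant at which the greedy shaper followed by a packetizer releases packet `n`. -/
noncomputable def shapedTime (σ : ℝ≥0 → ℝ≥0) (n : ℕ) : ℝ≥0∞ :=
  ⨅ (t : ℝ≥0) (_ : P.total (n + 1) ≤ minPlusConv (P.cumul ()).toFun σ t), (t : ℝ≥0∞)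

variable {P} {σ : ℝ≥0 → ℝ≥0}

theorem shapedTime_le {n : ℕ} {t : ℝ≥0}
    (h : P.total (n + 1) ≤ minPlusConv (P.cumul ()).toFun σ t) : P.shapedTime σ n ≤ t :=
  iInf₂_le t h

theorem shapedTime_mono : Monotone (P.shapedTime σ) := fun _ _ h =>
  le_iInf₂ fun _ ht => shapedTime_le ((P.total_mono (Nat.succ_le_succ h)).trans ht)

theorem time_le_shapedTime (hσ0 : σ 0 = 0) (n : ℕ) : P.time n ≤ P.shapedTime σ n :=
  le_iInf₂ fun t ht =>
    (P.time_lt_of_total_le (ht.trans (minPlusConv_le_left hσ0 t))).le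

theorem total_le_of_shapedTime_lt (hσ0 : σ 0 = 0) (hσm : Monotone σ) {n : ℕ} {u : ℝ≥0}
    (h : P.shapedTime σ n < u) : P.total (n + 1) ≤ minPlusConv (P.cumul ()).toFun σ u := by
  obtain ⟨t, ht⟩ := iInf_lt_iff.1 h
  obtain ⟨ht, htu⟩ := iInf_lt_iff.1 ht
  exact ht.trans (minPlusConv_mono (P.cumul ()).mono' hσm hσ0 (by exact_mod_cast htu.le))

/-- Packets `k, …, q` released by shaper and packetizer in the window `[s, u)` fit under `σ`. -/
theorem total_le_add_of_shapedTime (hσ0 : σ 0 = 0) (hσ : ConcaveOn ℝ≥0 Set.univ σ)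
    {Lmax l : ℝ≥0} (hl : Tendsto σ (𝓝[>] 0) (𝓝 l)) (hL : Lmax ≤ l) (hP : ∀ n, P.len n ≤ Lmax)
    {k q : ℕ} {s u : ℝ≥0} (hsu : s < u) (hk : (s : ℝ≥0∞) ≤ P.shapedTime σ k)
    (hq : P.shapedTime σ q < u) : P.total (q + 1) ≤ P.total k + σ (u - s) := by
  have hσm := hσ.nnreal_monotone
  have hqu := le_minPlusConv_iff.1 (total_le_of_shapedTime_lt hσ0 hσm hq)
  rcases eq_or_ne s 0 with rfl | hs0
  · have := hqu 0 zero_le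
    rw [(P.cumul ()).zero', zero_add] at this
    exact this.trans le_add_self
  have key : ∀ v < s, ∀ ε > 0, P.total (q + 1) ≤ P.total k + σ (u - v + ε) := by
    intro v hv ε hε
    -- Packet k is not yet complete at v, so some r makes R(r) + σ(v - r) too small; the same r is
    -- then used in the bound for packet q.
    have hck : ¬ P.total (k + 1) ≤ minPlusConv (P.cumul ()).toFun σ v := fun h =>
      absurd (hk.trans (shapedTime_le h)) (not_le.2 (by exact_mod_cast hv))
    rw [le_minPlusConv_iff] at hck
    push Not at hck
    obtain ⟨r, hrv, hr⟩ := hck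
    have hak : (P.cumul ()).toFun r ≤ P.total k :=
      P.cumul_le_total fun h =>
        absurd (P.total_le_cumul h) (not_le.2 (le_self_add.trans_lt hr))
    have hqr := hqu r (hrv.trans (hv.le.trans hsu.le))
    obtain ⟨x, rfl⟩ := exists_add_of_le hrv
    obtain ⟨y, rfl⟩ := exists_add_of_le (hv.le.trans hsu.le)
    rw [add_tsub_cancel_left]
    rw [add_tsub_cancel_left] at hr
    rw [add_assoc, add_tsub_cancel_left] at hqr
    rcases eq_or_ne x 0 with rfl | hx0
    · rw [zero_add] at hqr
      exact hqr.trans (add_le_add hak (hσm le_self_add))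
    have hx : 0 < x := pos_iff_ne_zero.2 hx0
    -- The exchange needs a positive e = min x ε: σ vanishes at 0, but σ e already covers packet k.
    obtain ⟨d, hd⟩ := exists_add_of_le (min_le_left x ε)
    have hm0 : 0 < min x ε := lt_min hx hε
    have hex := hσ.nnreal_exchange (min x ε) d y
    rw [← hd] at hex
    have h1 : P.len k ≤ σ (min x ε) :=
      (hP k).trans (hL.trans (hσm.le_of_tendsto_nhdsGT_zero hl hm0))
    have h2 : σ (min x ε + y) ≤ σ (y + ε) := hσm (by rw [add_comm]; gcongr; exact min_le_right _ _)
    rw [P.total_succ k] at hr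
    rw [← NNReal.coe_le_coe] at *
    rw [← NNReal.coe_lt_coe] at hr
    push_cast at *
    linarith
  have hpos : 0 < u - s := tsub_pos_of_lt hsu
  have : P.total (q + 1) - P.total k ≤ σ (u - s) := by
    refine hσ.nnreal_le_of_forall_gt hpos fun z hz => ?_
    rw [tsub_le_iff_left]
    obtain ⟨w, hsw, hwz⟩ := exists_between hz
    -- If w ≥ u, the truncated difference u - w is 0, still below s.
    obtain ⟨v, hvs, hvw⟩ : ∃ v < s, u - v ≤ w := by
      refine ⟨u - w, ?_, ?_⟩
      · have hw := tsub_lt_iff_right hsu.le |>.1 hsw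
        rcases le_total w u with h | h
        · exact (tsub_lt_iff_left h).2 hw
        · rw [tsub_eq_zero_of_le h]
          exact pos_iff_ne_zero.2 hs0
      · exact tsub_tsub_le
    obtain ⟨ε, hε⟩ := exists_add_of_le hwz.le
    have hε0 : 0 < ε := by
      rw [pos_iff_ne_zero]
      rintro rfl
      exact hwz.ne (by rw [hε, add_zero])
    refine (key v hvs ε hε0).trans ?_
    gcongr
    refine hσm ?_
    rw [hε]
    gcongr
  exact tsub_le_iff_left.1 this

/-- Release times are monotone, so the packets released in [s, u) are consecutive and only the first
and last index matter. -/
theorem constrainedBy_shapedTime (hσ0 : σ 0 = 0) (hσ : ConcaveOn ℝ≥0 Set.univ σ)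
    {Lmax l : ℝ≥0} (hl : Tendsto σ (𝓝[>] 0) (𝓝 l)) (hL : Lmax ≤ l) (hP : ∀ n, P.len n ≤ Lmax)
    (n : ℕ) :
    ConstrainedBy (fun u : ℝ≥0 =>
      ∑ m ∈ Finset.range n, if P.shapedTime σ m < u then P.len m else 0) σ := by
  intro s u hsu
  dsimp only
  rcases hsu.eq_or_lt with rfl | hsu
  · exact le_self_add
  set W := (Finset.range n).filter fun m => ¬ P.shapedTime σ m < s ∧ P.shapedTime σ m < u with hW
  have hmem : ∀ m, m ∈ W ↔ m < n ∧ ¬ P.shapedTime σ m < s ∧ P.shapedTime σ m < u := by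
    simp [hW]
  rcases W.eq_empty_or_nonempty with hWe | hWn
  · refine le_trans (Finset.sum_le_sum fun m hm => ?_) le_self_add
    by_cases h1 : P.shapedTime σ m < u
    · have h2 : P.shapedTime σ m < s := by
        by_contra h2
        have := (hmem m).2 ⟨Finset.mem_range.1 hm, h2, h1⟩
        simp [hWe] at this
      simp [h1, h2]
    · simp [h1]
  obtain ⟨hk1, hk2, hk3⟩ := (hmem _).1 (W.min'_mem hWn)
  obtain ⟨hq1, hq2, hq3⟩ := (hmem _).1 (W.max'_mem hWn)
  have hu : (∑ m ∈ Finset.range n, if P.shapedTime σ m < u then P.len m else 0)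
      ≤ P.total (W.max' hWn + 1) := by
    rw [← Finset.sum_filter]
    refine Finset.sum_le_sum_of_subset fun m hm => ?_
    simp only [Finset.mem_filter, Finset.mem_range] at hm ⊢
    by_contra hlt
    have hle : W.max' hWn ≤ m := by omega
    have hmW : m ∈ W :=
      (hmem m).2 ⟨hm.1, fun h => hq2 ((shapedTime_mono hle).trans_lt h), hm.2⟩
    have := W.le_max' m hmW
    omega
  have hs : P.total (W.min' hWn)
      ≤ ∑ m ∈ Finset.range n, if P.shapedTime σ m < s then P.len m else 0 := by
    rw [← Finset.sum_filter]
    refine Finset.sum_le_sum_of_subset fun m hm => ?_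
    simp only [Finset.mem_filter, Finset.mem_range] at hm ⊢
    refine ⟨hm.trans hk1, ?_⟩
    by_contra hns
    have := W.min'_le m ((hmem m).2
      ⟨hm.trans hk1, hns, (shapedTime_mono hm.le).trans_lt hk3⟩)
    omega
  refine hu.trans ((total_le_add_of_shapedTime hσ0 hσ hl hL hP
    hsu (not_lt.1 hk2) hq3).trans ?_)
  gcongr

end PacketSeq

/-! ### The regulator as greedy shaper plus packetizer -/

theorem shapedTime_le_pfrTime {σ : ℝ≥0 → ℝ≥0} (P : PacketSeq Unit) (n : ℕ) :
    P.shapedTime σ n ≤ pfrTime σ P n := by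
  rw [pfrTime]
  refine le_sInf fun t ⟨h1, h2, h3⟩ => ?_
  -- A packet released at t is counted only strictly after t, hence the ε.
  refine ENNReal.le_of_forall_pos_le_add fun ε hε ht => ?_
  lift t to ℝ≥0 using ht.ne
  rw [← ENNReal.coe_add]
  refine PacketSeq.shapedTime_le (le_minPlusConv_iff.2 fun s hs => ?_)
  have htu : (t : ℝ≥0∞) < (t + ε : ℝ≥0) := by exact_mod_cast lt_add_of_pos_right t hε
  have h := h3 s (t + ε) hs
  beta_reduce at h
  have hsum : (∑ m : Fin n, if pfrTime σ P m < (t + ε : ℝ≥0) then P.len m else 0) = P.total n := by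
    rw [PacketSeq.total, ← Fin.sum_univ_eq_sum_range]
    exact Finset.sum_congr rfl fun m _ => if_pos ((h2 m).trans_lt htu)
  rw [hsum, if_pos htu, ← P.total_succ] at h
  refine h.trans ?_
  gcongr
  have hle := P.sum_ite_le_cumul (τ := fun m => if m < n then pfrTime σ P m else t) (n := n + 1)
    (fun m hm => by
      split_ifs with hmn
      · exact time_le_pfrTime σ P m
      · obtain rfl : m = n := by omega
        exact h1) s
  refine le_trans (le_of_eq ?_) hle
  rw [Finset.sum_range_succ, ← Fin.sum_univ_eq_sum_range
    (fun m => if (if m < n then pfrTime σ P m else t) < (s : ℝ≥0∞) then P.len m else 0)]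
  simp

theorem pfrTime_eq_shapedTime {σ : ℝ≥0 → ℝ≥0} (hσ0 : σ 0 = 0)
    (hσ : ConcaveOn ℝ≥0 Set.univ σ) {Lmax l : ℝ≥0} (hl : Tendsto σ (𝓝[>] 0) (𝓝 l))
    (hL : Lmax ≤ l) {P : PacketSeq Unit} (hP : ∀ n, P.len n ≤ Lmax) (n : ℕ) :
    pfrTime σ P n = P.shapedTime σ n := by
  induction n using Nat.strong_induction_on with
  | _ n ih =>
    refine le_antisymm ?_ (shapedTime_le_pfrTime P n)
    rw [pfrTime]
    refine sInf_le ⟨PacketSeq.time_le_shapedTime hσ0 n, fun m => ?_, ?_⟩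
    · rw [ih m m.2]
      exact PacketSeq.shapedTime_mono m.2.le
    · have h := PacketSeq.constrainedBy_shapedTime hσ0 hσ hl hL hP (n + 1)
      convert h using 2 with u
      rw [Finset.sum_range_succ, ← Fin.sum_univ_eq_sum_range
        (fun m => if P.shapedTime σ m < (u : ℝ≥0∞) then P.len m else 0)]
      congr 1
      exact Finset.sum_congr rfl fun m _ => by rw [ih m m.2]

theorem pfr_offersFluidServiceCurve {σ : ℝ≥0 → ℝ≥0} (hσ0 : σ 0 = 0)
    (hσ : ConcaveOn ℝ≥0 Set.univ σ) {Lmax l : ℝ≥0} (hl : Tendsto σ (𝓝[>] 0) (𝓝 l))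
    (hL : Lmax ≤ l) : OffersFluidServiceCurve (pfr σ Lmax) σ := by
  refine ⟨hσ0, greedyShaper σ, fun a => ⟨fun f => (a f).shape hσ0 hσ, fun t => rfl⟩, ?_, ?_,
    ⟨hσ.nnreal_monotone, ?_⟩, ?_⟩
  · intro a c h _ t
    exact (h t).trans_le (minPlusConv_le_left hσ0 t)
  · intro a c _ s t
    exact (le_total ((c ()).toFun t) ((a ()).toFun s)).imp (fun h _ => h) (fun h _ => h)
  · intro a c h t
    rw [Traffic.aggregate_unit, Traffic.aggregate_unit, h t]
  · rintro P ⟨_, hP, -⟩ Q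
    have hout : ∀ c, greedyShaper σ P.cumul c → ∀ n,
        pfrTime σ P n = ⨅ (t : ℝ≥0)
          (_ : ∑ m ∈ Finset.range (n + 1), P.len m ≤ Traffic.aggregate c t), (t : ℝ≥0∞) := by
      intro c hc n
      rw [pfrTime_eq_shapedTime hσ0 hσ hl hL hP, Traffic.aggregate_unit, funext hc]
      rfl
    constructor
    · rintro ⟨-, rfl⟩
      exact ⟨fun f => (P.cumul f).shape hσ0 hσ, fun t => rfl, rfl, rfl, hout _ fun t => rfl⟩
    · rintro ⟨c, hc, hlen, hflow, htime⟩
      refine ⟨hP, PacketSeq.ext (funext fun n => ?_) hlen hflow⟩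
      exact (htime n).trans (hout c hc n).symm

/-! ### Shaping for free -/

theorem le_of_delay_lt {a b : Traffic Unit} {t D : ℝ≥0} (h : delay a b t < D) :
    (a ()).toFun t ≤ (b ()).toFun (t + D) := by
  obtain ⟨τ, hτ⟩ := iInf_lt_iff.1 h
  obtain ⟨hτ, hτD⟩ := iInf_lt_iff.1 hτ
  rw [Traffic.aggregate_unit, Traffic.aggregate_unit] at hτ
  exact hτ.trans ((b ()).mono' (by gcongr; exact_mod_cast hτD.le))

theorem delay_le {a b : Traffic Unit} {t D : ℝ≥0} (h : (a ()).toFun t ≤ (b ()).toFun (t + D)) :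
    delay a b t ≤ D :=
  iInf₂_le D (by rwa [Traffic.aggregate_unit, Traffic.aggregate_unit])

theorem explainsShapingForFree_unit {σ : ℝ≥0 → ℝ≥0} (hσ0 : σ 0 = 0) :
    ExplainsShapingForFree (fun _ : Unit => σ) σ := by
  refine ⟨hσ0, fun S Z' _ _ hZ _ hβ => le_antisymm ?_ ?_⟩
  · refine iSup₂_mono fun x hx => iSup_mono fun t => le_iInf₂ fun τ hτ => iInf₂_le τ ?_
    rw [Traffic.aggregate_unit, Traffic.aggregate_unit] at *
    exact hτ.trans (hZ _ _ hx.2.1 _ _)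
  · refine iSup₂_le fun x hx => iSup_le fun t => ?_
    refine ENNReal.le_of_forall_pos_le_add fun ε hε hfin => ?_
    set W := ⨆ x ∈ constrainedTrajectories (fun _ : Unit => σ) S Z', ⨆ t, delay x.1 x.2.1 t with hW
    lift W to ℝ≥0 using hfin.ne with D
    -- The infimum defining a delay need not be attained; D + ε is a delay that works for all data.
    have hab : ∀ r, (x.1 ()).toFun r ≤ (x.2.1 ()).toFun (r + (D + ε)) := fun r => by
      refine le_of_delay_lt (lt_of_le_of_lt (b := (D : ℝ≥0∞)) ?_ ?_)
      · rw [hW]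
        exact (le_iSup (fun t => delay x.1 x.2.1 t) r).trans
          (le_iSup₂ (f := fun (x : Traffic Unit × Traffic Unit × Traffic Unit)
            (_ : x ∈ constrainedTrajectories (fun _ : Unit => σ) S Z') =>
              ⨆ t, delay x.1 x.2.1 t) x hx)
      · exact_mod_cast lt_add_of_pos_right D hε
    rw [← ENNReal.coe_add]
    refine delay_le ?_
    have hc := hβ.2 _ _ hx.2.1 (t + (D + ε))
    rw [Traffic.aggregate_unit, Traffic.aggregate_unit] at hc
    refine le_trans (le_minPlusConv_iff.2 fun s hs => ?_) hc
    have hcon := hx.2.2 ()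
    rcases le_total s (D + ε) with h | h
    · have h0 := hcon 0 t zero_le
      rw [(x.1 ()).zero', zero_add, tsub_zero] at h0
      refine (h0.trans (hβ.1 ?_)).trans le_add_self
      rw [add_tsub_assoc_of_le h]
      exact le_self_add
    · obtain ⟨r, rfl⟩ := exists_add_of_le h
      rw [add_comm (D + ε) r] at hs ⊢
      rw [add_tsub_add_eq_tsub_right]
      refine (hcon r t (le_of_add_le_add_right hs)).trans ?_
      gcongr
      exact hab r

theorem mainTheorem7 (σ : ℝ≥0 → ℝ≥0) (hσ0 : σ 0 = 0) (hσ : ConcaveOn ℝ≥0 Set.univ σ)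
    (Lmax l : ℝ≥0) (hl : Tendsto σ (𝓝[>] 0) (𝓝 l)) (hL : Lmax ≤ l) :
    OffersFluidServiceCurve (pfr σ Lmax) σ ∧
      ExplainsShapingForFree (fun _ : Unit => σ) σ :=
  ⟨pfr_offersFluidServiceCurve hσ0 hσ hl hL, explainsShapingForFree_unit hσ0⟩
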